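/- For $\varepsilon>0$ let $F:\mathbb R^3\to\mathbb R^3$ and $G:\mathbb R^2\to\mathbb R^2$ be the real analytic maps $$F(x,y,z)=\bigl(y(e^x-1)+x^2+y^2+z^2-\varepsilon^2,\;y(e^{\sqrt2\,x}-1),\;y(e^{\sqrt3\,x}-1)\bigr),$$ $$G(x,y)=\bigl(y(e^{\sqrt2\,x}-1),\;y(e^{\sqrt3\,x}-1)\bigr).$$ Let $\Omega$ be the interior of the image under $F$ of the closed Euclidean ball $\bar B_3(0,\varepsilon)$, and let $\Gamma=G(\bar B_2(0,\varepsilon))$. There is an $\varepsilon_0>0$ such that for every $0<\varepsilon<\varepsilon_0$ the following holds. Every $(v,w)\in\Gamma\setminus\{(0,0)\}$ has exactly one preimage $G^{-1}(v,w)=(x,y)$ under $G$ in $\bar B_2(0,\varepsilon)$, and $(v,w)\in\Gamma\setminus\{(0,0)\}$ whenever $(u,v,w)\in\Omega$. Thus one may define $\varphi(v,w)=x^2+y^2$ and $\psi(v,w)=y(e^x-1)$ for $(v,w)\in\Gamma\setminus\{(0,0)\}$ with $(x,y)=G^{-1}(v,w)$, and a function $f:\mathbb R^3\to\mathbb R$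 by $$f(u,v,w)=\bigl(\psi(v,w)-u\bigr)\bigl(u-\psi(v,w)-\varphi(v,w)+\varepsilon^2\bigr)\ \text{ for }(u,v,w)\in\Omega,\qquad f=0\ \text{ outside }\Omega.$$ Put $\tilde f(u,v,w)=f(u,v,w)\,v^2w^2$. Then $\tilde f$ is nonnegative, continuous and subanalytic on $\mathbb R^3$ (its graph is a subanalytic subset of $\mathbb R^3\times\mathbb R$), $$\Omega=\{(u,v,w)\in\mathbb R^3:\ \tilde f(u,v,w)>0\},$$ and $\tilde f$ is $C^\infty$ on $\mathbb R^3\setminus\partial\Omega$. Moreover, the open set $\Omega$ is not semianalytic in $\mathbb R^3$. Here a subset $S$ of $\mathbb R^n$ is semianalytic if every point of $\mathbb R^n$ has an open neighbourhood $U$ such that $S\cap U$ belongs to the Boolean algebra of subsets of $U$ generated by the sets $\{x\in U: g(x)>0\}$ with $g$ real analytic on $U$; and $S$ is subanalytic if every point of $\mathbb R^n$ has an open neighbourhood $U$ such that $S\cap U$ is the image, under the projection $\mathbb R^n\times\mathbb R^m\to\mathbb R^n$ for some $m$, of a relatively compact semianalytic subset of $\mathbb R^n\times\mathbb R^m$.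 -/

import Mathlib

open Set Metric Topology
open scoped ContDiff

/-! ## Semianalytic and subanalytic sets -/

namespace Subanalytic

variable {E : Type*} [NormedAddCommGroup E] [NormedSpace ℝ E]

/-- The Boolean algebra of subsets of `U` generated by the sets `{x ∈ U | 0 < f x}`
with `f` real analytic on `U`. -/
inductive AnalyticGenerated (U : Set E) : Set E → Prop
  | pos (f : E → ℝ) (hf : AnalyticOnNhd ℝ f U) : AnalyticGenerated U {x ∈ U | 0 < f x}
  | union {A B : Set E} (hA : AnalyticGenerated U A) (hB : AnalyticGenerated U B) :
      AnalyticGenerated U (A ∪ B)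
  | inter {A B : Set E} (hA : AnalyticGenerated U A) (hB : AnalyticGenerated U B) :
      AnalyticGenerated U (A ∩ B)
  | compl {A : Set E} (hA : AnalyticGenerated U A) : AnalyticGenerated U (U \ A)

/-- `S` is semianalytic: every point of the ambient space (not only of `S`) has an open
neighbourhood `U` in which `S` is described by finitely many equations and inequalities between
real analytic functions on `U`. -/
def IsSemianalytic (S : Set E) : Prop :=
  ∀ a : E, ∃ U : Set E, IsOpen U ∧ a ∈ U ∧ AnalyticGenerated U (S ∩ U)

/-- `S` is subanalytic: near every point of the ambient space it is the projection of a
relatively compact semianalytic subset of `E × ℝ^m`. -/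
def IsSubanalytic (S : Set E) : Prop :=
  ∀ a : E, ∃ U : Set E, IsOpen U ∧ a ∈ U ∧
    ∃ (m : ℕ) (A : Set (E × EuclideanSpace ℝ (Fin m))),
      IsSemianalytic A ∧ IsCompact (closure A) ∧ S ∩ U = Prod.fst '' A

/-- A real function is subanalytic if its graph is a subanalytic subset of `E × ℝ`
(this is used for continuous functions). -/
def IsSubanalyticFun (f : E → ℝ) : Prop :=
  IsSubanalytic {p : E × ℝ | p.2 = f p.1}

end Subanalytic

/-! ## The example -/

namespace Trefoil

noncomputable section

/-- `F(x,y,z) = (y(e^x - 1) + x² + y² + z² - ε², y(e^{√2 x} - 1), y(e^{√3 x} - 1))`. -/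
def F (ε : ℝ) (p : EuclideanSpace ℝ (Fin 3)) : EuclideanSpace ℝ (Fin 3) :=
  !₂[p 1 * (Real.exp (p 0) - 1) + p 0 ^ 2 + p 1 ^ 2 + p 2 ^ 2 - ε ^ 2,
     p 1 * (Real.exp (p 0 * √2) - 1),
     p 1 * (Real.exp (p 0 * √3) - 1)]

/-- `Ω` is the interior of the image under `F` of the closed Euclidean ball of radius `ε`. -/
def Omega (ε : ℝ) : Set (EuclideanSpace ℝ (Fin 3)) :=
  interior (F ε '' closedBall 0 ε)

/-- `G(x,y) = (y(e^{√2 x} - 1), y(e^{√3 x} - 1))`. -/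
def G (q : EuclideanSpace ℝ (Fin 2)) : EuclideanSpace ℝ (Fin 2) :=
  !₂[q 1 * (Real.exp (q 0 * √2) - 1), q 1 * (Real.exp (q 0 * √3) - 1)]

/-- `Γ` is the image under `G` of the closed Euclidean disc of radius `ε`. -/
def Gam (ε : ℝ) : Set (EuclideanSpace ℝ (Fin 2)) :=
  G '' closedBall 0 ε

/-- `G⁻¹` on `Γ \ {0}`: a point of the closed disc of radius `ε` which `G` sends to `r`
(it is the only one for `r ∈ Γ \ {0}` and small `ε`; only such `r` matter below). -/
def Ginv (ε : ℝ) (r : EuclideanSpace ℝ (Fin 2)) : EuclideanSpace ℝ (Fin 2) :=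
  Function.invFunOn G (closedBall 0 ε) r

/-- `φ(v,w) = ‖G⁻¹(v,w)‖²`. -/
def phi (ε v w : ℝ) : ℝ := ‖Ginv ε !₂[v, w]‖ ^ 2

/-- `ψ(v,w) = y(e^x - 1)` where `(x,y) = G⁻¹(v,w)`. -/
def psi (ε v w : ℝ) : ℝ :=
  Ginv ε !₂[v, w] 1 * (Real.exp (Ginv ε !₂[v, w] 0) - 1)

/-- `f(u,v,w) = (ψ(v,w) - u)(u - ψ(v,w) - φ(v,w) + ε²)` on `Ω`, and `f = 0` outside `Ω`. -/
def f (ε : ℝ) : EuclideanSpace ℝ (Fin 3) → ℝ :=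
  (Omega ε).indicator fun p =>
    (psi ε (p 1) (p 2) - p 0) * (p 0 - psi ε (p 1) (p 2) - phi ε (p 1) (p 2) + ε ^ 2)

/-- `f̃(u,v,w) = f(u,v,w) v² w²`. -/
def fTilde (ε : ℝ) (p : EuclideanSpace ℝ (Fin 3)) : ℝ :=
  f ε p * p 1 ^ 2 * p 2 ^ 2

end

end Trefoil

/-! ### Convexity inequalities for exponentials and the cone swept by `G`. -/

namespace Trefoil

/-! The ratio of the components of `G` depends on `x` alone and is strictly increasing
(`exp_ratio_lt`), so `G` is injective off the axes. Over `(v, w) = G (x, y)` with `x, y ≠ 0`, the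
image of the ball under `F` is the segment `ψ + φ - ε² ≤ u ≤ ψ`, and `u - ψ - φ + ε² = z²`. Hence
`fTilde ∘ F` equals the explicit function `pullback` on the closed ball (`fTilde_F`). It is positive
exactly at interior points of the ball off the coordinate planes, where `F` is a local
diffeomorphism; these points map onto `Omega`. Continuity follows from compactness of the ball,
smoothness from local inverses, and subanalyticity from `GraphCond`, whose auxiliary variables stay
in the ball.

The top `u = ψ` of the segments consists of the points `y • dir x`, a cone accumulating at the
origin. Since `e^x`, `e^{√2 x}`, `e^{√3 x}` are algebraically independent, no nonzero homogeneous
form, hence no nonzero analytic germ at the origin, vanishes on this cone. Analytic conditions near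
the origin are therefore locally constant at most of its points
(`AnalyticGenerated.eventually_const`), although the cone bounds `Omega` there. -/

theorem sqrt_two_lt_sqrt_three : √2 < √3 := Real.sqrt_lt_sqrt (by norm_num) (by norm_num)

theorem exp_mul_sub_one_ne_zero {c x : ℝ} (hc : 0 < c) (hx : x ≠ 0) :
    Real.exp (x * c) - 1 ≠ 0 := by
  rw [sub_ne_zero, Ne, Real.exp_eq_one_iff]
  exact mul_ne_zero hx hc.ne'

theorem exp_sqrt_two_sub_one_ne_zero {x : ℝ} (hx : x ≠ 0) : Real.exp (x * √2) - 1 ≠ 0 :=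
  exp_mul_sub_one_ne_zero (by positivity) hx

theorem exp_sqrt_three_sub_one_ne_zero {x : ℝ} (hx : x ≠ 0) : Real.exp (x * √3) - 1 ≠ 0 :=
  exp_mul_sub_one_ne_zero (by positivity) hx

/-- Strict convexity of `exp` between `0` and `x * √3`, at the intermediate point `x * √2`. -/
theorem sqrt_three_mul_exp_lt {x : ℝ} (hx : x ≠ 0) :
    √3 * (Real.exp (x * √2) - 1) < √2 * (Real.exp (x * √3) - 1) := by
  have h3 : 0 < √3 := by positivity
  have h2 : 0 < √2 := by positivity
  have h23 := sqrt_two_lt_sqrt_three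
  have := strictConvexOn_exp.2 (mem_univ (x * √3)) (mem_univ 0) (mul_ne_zero hx h3.ne')
    (div_pos h2 h3) (div_pos (sub_pos.2 h23) h3) (by field_simp; ring)
  simp only [smul_eq_mul, mul_zero, add_zero, Real.exp_zero, mul_one] at this
  rw [show √2 / √3 * (x * √3) = x * √2 by field_simp] at this
  have e : √2 / √3 * Real.exp (x * √3) + (√3 - √2) / √3
      = (√2 * (Real.exp (x * √3) - 1) + √3) / √3 := by field_simp; ring
  rw [e, lt_div_iff₀ h3] at this
  linarith

/-- This is the preceding inequality at `-x`, multiplied by `e^{(√2 + √3) x}`. Up to the factor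
`-y`, the difference of the two sides is the Jacobian determinant of `G`. -/
theorem jacobian_pos {x : ℝ} (hx : x ≠ 0) :
    √2 * Real.exp (x * √2) * (Real.exp (x * √3) - 1) <
      √3 * Real.exp (x * √3) * (Real.exp (x * √2) - 1) := by
  have h := sqrt_three_mul_exp_lt (neg_ne_zero.2 hx)
  have e2 : Real.exp (-x * √2) * Real.exp (x * √2) = 1 := by rw [← Real.exp_add]; simp
  have e3 : Real.exp (-x * √3) * Real.exp (x * √3) = 1 := by rw [← Real.exp_add]; simp
  have hp : 0 < Real.exp (x * √2) * Real.exp (x * √3) := by positivity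
  have h' := mul_lt_mul_of_pos_right h hp
  have l : √3 * (Real.exp (-x * √2) - 1) * (Real.exp (x * √2) * Real.exp (x * √3))
      = √3 * Real.exp (x * √3) * (1 - Real.exp (x * √2)) := by
    linear_combination (√3 * Real.exp (x * √3)) * e2
  have r : √2 * (Real.exp (-x * √3) - 1) * (Real.exp (x * √2) * Real.exp (x * √3))
      = √2 * Real.exp (x * √2) * (1 - Real.exp (x * √3)) := by
    linear_combination (√2 * Real.exp (x * √2)) * e3
  rw [l, r] at h'
  linarith

/-- In the variable `s = e^{√2 x}` the ratio is the slope of the secant of `s ^ (√3/√2)` from `s =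
1`, and this power is strictly convex. -/
theorem exp_ratio_lt {x y : ℝ} (hx : x ≠ 0) (hy : y ≠ 0) (hxy : x < y) :
    (Real.exp (x * √3) - 1) / (Real.exp (x * √2) - 1) <
      (Real.exp (y * √3) - 1) / (Real.exp (y * √2) - 1) := by
  have h2 : 0 < √2 := by positivity
  have key : ∀ t : ℝ, Real.exp (t * √2) ^ (√3 / √2) = Real.exp (t * √3) := fun t => by
    rw [← Real.exp_mul]; congr 1; field_simp
  have := (strictConvexOn_rpow ((one_lt_div h2).2 sqrt_two_lt_sqrt_three)).secant_strict_mono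
    (a := 1) (x := Real.exp (x * √2)) (y := Real.exp (y * √2)) (by simp)
    (Real.exp_pos _).le (Real.exp_pos _).le
    (sub_ne_zero.1 (exp_sqrt_two_sub_one_ne_zero hx))
    (sub_ne_zero.1 (exp_sqrt_two_sub_one_ne_zero hy))
    (Real.exp_lt_exp.2 (mul_lt_mul_of_pos_right hxy h2))
  simpa only [key, Real.one_rpow] using this

theorem exp_ratio_le {x y : ℝ} (hx : x ≠ 0) (hy : y ≠ 0) (hxy : x ≤ y) :
    (Real.exp (x * √3) - 1) / (Real.exp (x * √2) - 1) ≤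
      (Real.exp (y * √3) - 1) / (Real.exp (y * √2) - 1) := by
  rcases hxy.eq_or_lt with rfl | h
  · exact le_rfl
  · exact (exp_ratio_lt hx hy h).le

theorem exp_ratio_injective {x y : ℝ} (hx : x ≠ 0) (hy : y ≠ 0)
    (h : (Real.exp (x * √3) - 1) / (Real.exp (x * √2) - 1) =
      (Real.exp (y * √3) - 1) / (Real.exp (y * √2) - 1)) : x = y := by
  rcases lt_trichotomy x y with h' | h' | h'
  · exact absurd h (exp_ratio_lt hx hy h').ne
  · exact h'
  · exact absurd h (exp_ratio_lt hy hx h').ne'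

/-- The two components of `G` determine the point off the coordinate axes. -/
theorem eq_of_components_eq {x y x' y' : ℝ} (hx : x ≠ 0) (hy : y ≠ 0)
    (h2 : y * (Real.exp (x * √2) - 1) = y' * (Real.exp (x' * √2) - 1))
    (h3 : y * (Real.exp (x * √3) - 1) = y' * (Real.exp (x' * √3) - 1)) : x = x' ∧ y = y' := by
  have hA := exp_sqrt_two_sub_one_ne_zero hx
  have hne : y' * (Real.exp (x' * √2) - 1) ≠ 0 := h2 ▸ mul_ne_zero hy hA
  have hx' : x' ≠ 0 := by rintro rfl; simp at hne
  have hy' : y' ≠ 0 := left_ne_zero_of_mul hne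
  have hA' := exp_sqrt_two_sub_one_ne_zero hx'
  obtain rfl : x = x' := by
    refine exp_ratio_injective hx hx' ?_
    rw [← mul_div_mul_left _ _ hy, h2, h3, mul_div_mul_left _ _ hy']
  exact ⟨rfl, mul_right_cancel₀ hA h2⟩

/-- Each factor is linear in the components and vanishes on one of the two lines bounding the cone.
By monotonicity the slope at `x` lies between the slopes at `-ε` and `ε`. The sign changes of the
slope difference and of `e^{s√2} - 1` between `s = ε` and `s = -ε` compensate. -/
theorem mul_components_nonneg {ε x : ℝ} (y : ℝ) (hε : 0 < ε) (hx : x ≠ 0)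
    (h1 : -ε ≤ x) (h2 : x ≤ ε) :
    0 ≤ (y * (Real.exp (x * √2) - 1) * (Real.exp (ε * √3) - 1) -
          y * (Real.exp (x * √3) - 1) * (Real.exp (ε * √2) - 1)) *
        (y * (Real.exp (x * √2) - 1) * (Real.exp (-ε * √3) - 1) -
          y * (Real.exp (x * √3) - 1) * (Real.exp (-ε * √2) - 1)) := by
  have key : ∀ s, s ≠ 0 → y * (Real.exp (x * √2) - 1) * (Real.exp (s * √3) - 1) -
          y * (Real.exp (x * √3) - 1) * (Real.exp (s * √2) - 1) =
      y * (Real.exp (x * √2) - 1) * (Real.exp (s * √2) - 1) *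
        ((Real.exp (s * √3) - 1) / (Real.exp (s * √2) - 1) -
        (Real.exp (x * √3) - 1) / (Real.exp (x * √2) - 1)) := fun s hs => by
    have h1 := exp_sqrt_two_sub_one_ne_zero hs
    have h2 := exp_sqrt_two_sub_one_ne_zero hx
    generalize Real.exp (s * √2) - 1 = a at *
    generalize Real.exp (x * √2) - 1 = b at *
    field_simp
  rw [key ε hε.ne', key (-ε) (neg_ne_zero.2 hε.ne')]
  have a1 := exp_ratio_le hx hε.ne' h2
  have a2 := exp_ratio_le (neg_ne_zero.2 hε.ne') hx h1
  have b1 : 0 ≤ Real.exp (ε * √2) - 1 := sub_nonneg.2 (Real.one_le_exp (by positivity))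
  have b2 : Real.exp (-ε * √2) - 1 ≤ 0 :=
    sub_nonpos.2 (Real.exp_le_one_iff.2 (by rw [neg_mul]; exact neg_nonpos.2 (by positivity)))
  have c := mul_nonneg (sub_nonneg.2 a1) (sub_nonneg.2 a2)
  have d := mul_nonneg b1 (neg_nonneg.2 b2)
  have := mul_nonneg (mul_nonneg (sq_nonneg (y * (Real.exp (x * √2) - 1))) c) d
  refine this.trans_eq ?_
  ring

/-- If the ray through `(v, w)` lies in the cone swept by `G` on the strip `|x| ≤ ε` and is not its
axis of tangency, then it is swept at some `x ≠ 0`. -/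
theorem exists_zero_of_mul_nonneg {ε v w : ℝ} (hε : 0 < ε) (hvw : v * √3 ≠ w * √2)
    (h : 0 ≤ (v * (Real.exp (ε * √3) - 1) - w * (Real.exp (ε * √2) - 1)) *
        (v * (Real.exp (-ε * √3) - 1) - w * (Real.exp (-ε * √2) - 1))) :
    ∃ x, x ≠ 0 ∧ -ε ≤ x ∧ x ≤ ε ∧
      v * (Real.exp (x * √3) - 1) - w * (Real.exp (x * √2) - 1) = 0 := by
  set k : ℝ → ℝ := fun x => v * (Real.exp (x * √3) - 1) - w * (Real.exp (x * √2) - 1) with hk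
  have hd : HasDerivAt k (v * √3 - w * √2) 0 := by
    have e : ∀ c : ℝ, HasDerivAt (fun x : ℝ => Real.exp (x * c) - 1) c 0 := fun c => by
      simpa using (((hasDerivAt_id (0 : ℝ)).mul_const c).exp.sub_const 1)
    exact ((e _).const_mul v).sub ((e _).const_mul w)
  have hkc : Continuous k := by fun_prop
  -- `k` always has the useless root `0`. Dividing it out leaves a continuous function whose value
  -- at `0` is `v * √3 - w * √2 ≠ 0`, so any root found by the intermediate value theorem is
  -- nonzero.
  have hc : Continuous (dslope k 0) := by
    rw [← continuousOn_univ, continuousOn_dslope Filter.univ_mem]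
    exact ⟨hkc.continuousOn, hd.differentiableAt⟩
  have hk0 : k 0 = 0 := by simp [hk]
  have hs : ∀ x, x ≠ 0 → dslope k 0 x = x⁻¹ * k x := fun x hx => by
    rw [dslope_of_ne _ hx, slope_def_field, hk0]; field_simp; ring
  have hprod : dslope k 0 ε * dslope k 0 (-ε) ≤ 0 := by
    rw [hs _ hε.ne', hs _ (neg_ne_zero.2 hε.ne')]
    have : 0 ≤ ε⁻¹ * ε⁻¹ * (k ε * k (-ε)) := mul_nonneg (by positivity) h
    rw [inv_neg]; linarith
  have hle : -ε ≤ ε := by linarith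
  obtain ⟨x, hx, hx0⟩ : ∃ x ∈ Icc (-ε) ε, dslope k 0 x = 0 := by
    rcases mul_nonpos_iff.1 hprod with ⟨h1, h2⟩ | ⟨h1, h2⟩
    · exact intermediate_value_Icc hle hc.continuousOn ⟨h2, h1⟩
    · exact intermediate_value_Icc' hle hc.continuousOn ⟨h1, h2⟩
  have hxne : x ≠ 0 := by
    rintro rfl
    rw [dslope_same, hd.deriv] at hx0
    exact hvw (sub_eq_zero.1 hx0)
  rw [hs x hxne] at hx0
  exact ⟨x, hxne, hx.1, hx.2, (mul_eq_zero.1 hx0).resolve_left (inv_ne_zero hxne)⟩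

end Trefoil

namespace Trefoil

/-! ### Linear independence of exponentials -/

/-- If `b * c ≠ 0`, squaring `b√2 + c√3 = -a` would make `√6` rational; otherwise irrationality of
`√2` or `√3` decides. -/
theorem linear_relation_trivial {a b c : ℤ} (h : (a : ℝ) + b * √2 + c * √3 = 0) :
    a = 0 ∧ b = 0 ∧ c = 0 := by
  have h2 : √2 ^ 2 = 2 := Real.sq_sqrt (by norm_num)
  have h3 : √3 ^ 2 = 3 := Real.sq_sqrt (by norm_num)
  have i2 : Irrational √2 := Nat.prime_two.irrational_sqrt
  have i3 : Irrational √3 := Nat.prime_three.irrational_sqrt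
  have i6 : Irrational (√2 * √3) := by
    rw [← Real.sqrt_mul (by norm_num)]
    norm_num
  have hbc : b * c = 0 := by
    by_contra hne
    have e : ((2 * (b * c) : ℤ) : ℝ) * (√2 * √3) = ((a ^ 2 - 2 * b ^ 2 - 3 * c ^ 2 : ℤ) : ℝ) := by
      push_cast
      linear_combination (b * √2 + c * √3 - a) * h - (b : ℝ) ^ 2 * h2 - (c : ℝ) ^ 2 * h3
    exact (i6.intCast_mul (mul_ne_zero two_ne_zero hne)).ne_int _ e
  rcases mul_eq_zero.1 hbc with rfl | rfl
  · by_cases hc : c = 0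
    · subst hc; simpa using h
    · refine absurd ?_ ((i3.intCast_mul hc).ne_int (-a))
      push_cast at h ⊢; linarith
  · by_cases hb : b = 0
    · subst hb; simpa using h
    · refine absurd ?_ ((i2.intCast_mul hb).ne_int (-a))
      push_cast at h ⊢; linarith

/-- The character `t ↦ e^{rt}` of the additive group of the reals. -/
noncomputable def expChar (r : ℝ) : Multiplicative ℝ →* ℝ where
  toFun t := Real.exp (t.toAdd * r)
  map_one' := by simp
  map_mul' s t := by simp [add_mul, Real.exp_add]

theorem expChar_injective : Function.Injective expChar := fun r s h => by
  have := DFunLike.congr_fun h (Multiplicative.ofAdd 1)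
  simpa [expChar] using this

theorem expRate_injective :
    Function.Injective fun m : Fin 3 →₀ ℕ => (m 0 : ℝ) + m 1 * √2 + m 2 * √3 := fun m n h => by
  have := linear_relation_trivial (a := m 0 - n 0) (b := m 1 - n 1) (c := m 2 - n 2)
    (by push_cast; simp only at h; linarith)
  ext i
  fin_cases i <;> simp <;> omega

/-- `e^x`, `e^{√2 x}`, `e^{√3 x}` are algebraically independent. -/
theorem mvPolynomial_eq_zero_of_exp (Q : MvPolynomial (Fin 3) ℝ)
    (h : ∀ x : ℝ, MvPolynomial.eval ![Real.exp x, Real.exp (x * √2), Real.exp (x * √3)] Q = 0) :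
    Q = 0 := by
  -- Dedekind's independence of characters: distinct monomials in the three exponentials are
  -- distinct characters, by `expRate_injective`.
  have li := (linearIndependent_monoidHom (Multiplicative ℝ) ℝ).comp _
    (expChar_injective.comp expRate_injective)
  rw [linearIndependent_iff'] at li
  have hz := li Q.support (fun m => Q.coeff m) <| by
    ext x
    rw [Pi.zero_apply, ← h x.toAdd, MvPolynomial.eval_eq', Finset.sum_apply]
    refine Finset.sum_congr rfl fun m _ => ?_
    simp only [Pi.smul_apply, smul_eq_mul, Function.comp_apply, expChar, MonoidHom.coe_mk,
      OneHom.coe_mk, Fin.prod_univ_three, Matrix.cons_val_zero, Matrix.cons_val_one,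
      Matrix.cons_val, ← Real.exp_nat_mul, ← Real.exp_add]
    congr 2
    ring
  ext m
  by_cases hm : m ∈ Q.support
  · simpa using hz m hm
  · simpa using hm

/-! ### Analytic germs along the cone over `dir`. -/

/-- The direction `(e^x - 1, e^{√2 x} - 1, e^{√3 x} - 1)`. -/
noncomputable def dir (x : ℝ) : EuclideanSpace ℝ (Fin 3) :=
  !₂[Real.exp x - 1, Real.exp (x * √2) - 1, Real.exp (x * √3) - 1]

/-- A homogeneous form which vanishes on the curve `dir` vanishes identically. -/
theorem multilinear_diag_eq_zero {n : ℕ} (q : EuclideanSpace ℝ (Fin 3) [×n]→L[ℝ] ℝ)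
    (h : ∀ x, q (fun _ => dir x) = 0) (v : EuclideanSpace ℝ (Fin 3)) : q (fun _ => v) = 0 := by
  let e : Fin 3 → EuclideanSpace ℝ (Fin 3) := fun i => EuclideanSpace.single i 1
  have expand : ∀ v : EuclideanSpace ℝ (Fin 3),
      q (fun _ => v) = ∑ r : Fin n → Fin 3, (∏ i, v (r i)) * q (fun i => e (r i)) := fun v => by
    have hv : v = ∑ j, v j • e j := by
      ext i
      simp [e, Finset.sum_apply, Pi.single_apply]
    conv_lhs => rw [hv]
    rw [q.map_sum (fun _ j => v j • e j)]
    refine Finset.sum_congr rfl fun r _ => ?_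
    rw [q.map_smul_univ (fun i => v (r i)) (fun i => e (r i)), smul_eq_mul]
  -- The shift `X - 1` turns evaluation at the exponentials into evaluation of the form at `dir x`;
  -- evaluating at `v i + 1` later recovers the form at `v`.
  let Q : MvPolynomial (Fin 3) ℝ := ∑ r : Fin n → Fin 3,
    (∏ i, (MvPolynomial.X (r i) - 1)) * MvPolynomial.C (q (fun i => e (r i)))
  have hQ : Q = 0 := mvPolynomial_eq_zero_of_exp Q fun x => by
    rw [← h x, expand]
    simp only [Q, map_sum, map_mul, map_prod, map_sub, MvPolynomial.eval_X, MvPolynomial.eval_C,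
      map_one]
    refine Finset.sum_congr rfl fun r _ => ?_
    congr 1
    refine Finset.prod_congr rfl fun i _ => ?_
    generalize r i = j
    fin_cases j <;> simp [dir]
  have := congrArg (MvPolynomial.eval fun i => v i + 1) hQ
  simpa [Q, ← expand] using this

theorem analyticAt_dir (x : ℝ) : AnalyticAt ℝ dir x := by
  have : dir = fun x => (EuclideanSpace.equiv (Fin 3) ℝ).symm
      ![Real.exp x - 1, Real.exp (x * √2) - 1, Real.exp (x * √3) - 1] := rfl
  rw [this]
  have hpi : AnalyticAt ℝ (fun x : ℝ =>
      ![Real.exp x - 1, Real.exp (x * √2) - 1, Real.exp (x * √3) - 1]) x := by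
    refine AnalyticAt.pi fun i => ?_
    fin_cases i <;> simp <;> fun_prop
  exact (ContinuousLinearEquiv.analyticAt _ _).comp hpi

open Filter in
/-- An analytic germ that vanishes on the cone over `dir` is zero. -/
theorem eventually_smul_dir_ne_zero {g : EuclideanSpace ℝ (Fin 3) → ℝ} (hg : AnalyticAt ℝ g 0)
    (h0 : ¬ ∀ᶠ p in 𝓝 0, g p = 0) :
    ∀ᶠ x in 𝓝[≠] (0 : ℝ), ∀ᶠ y in 𝓝[≠] (0 : ℝ), g (y • dir x) ≠ 0 := by
  by_contra hcon
  apply h0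
  obtain ⟨p, hp⟩ := hg
  have hline : ∀ v : EuclideanSpace ℝ (Fin 3), HasFPowerSeriesAt (fun y : ℝ => g (y • v))
      (p.compContinuousLinearMap ((ContinuousLinearMap.id ℝ ℝ).smulRight v)) 0 := fun v => by
    have : HasFPowerSeriesAt g p ((ContinuousLinearMap.id ℝ ℝ).smulRight v 0) := by simpa using hp
    exact this.compContinuousLinearMap
  have hfreq : ∃ᶠ x in 𝓝[≠] (0 : ℝ), ∀ n, p n (fun _ => dir x) = 0 := by
    rw [Filter.not_eventually] at hcon
    refine hcon.mono fun x hx => ?_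
    have hz : ∀ᶠ y in 𝓝 (0 : ℝ), g (y • dir x) = 0 :=
      ((hline (dir x)).analyticAt.eventually_eq_zero_or_eventually_ne_zero).resolve_right hx
    have hp0 := (hline (dir x)).eq_zero_of_eventually hz
    intro n
    have := congrArg (fun s : FormalMultilinearSeries ℝ ℝ ℝ => s n (fun _ => 1)) hp0
    simpa [FormalMultilinearSeries.compContinuousLinearMap, Function.comp_def] using this
  have hall : ∀ n v, p n (fun _ => v) = 0 := fun n => by
    refine multilinear_diag_eq_zero (p n) ?_
    -- The vanishing is known only for `x` accumulating at `0`; analyticity in `x` extends it to all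
    -- `x`.
    have han : AnalyticOnNhd ℝ (fun x => p n (fun _ => dir x)) univ := fun x _ =>
      AnalyticAt.comp (f := fun x _ => dir x) (p n).analyticAt
        (AnalyticAt.pi fun _ => analyticAt_dir x)
    have := han.eqOn_zero_of_preconnected_of_frequently_eq_zero isPreconnected_univ (mem_univ 0)
      (hfreq.mono fun x hx => hx n)
    exact fun x => this (mem_univ x)
  obtain ⟨r, hr⟩ := hp
  have hmem : Metric.eball (0 : EuclideanSpace ℝ (Fin 3)) r ∈ 𝓝 0 := Metric.eball_mem_nhds _ hr.r_pos
  filter_upwards [hmem] with y hy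
  have := hr.hasSum hy
  simp only [hall, zero_add] at this
  exact this.unique hasSum_zero

open Filter in
/-- A set described by analytic functions near the origin has no boundary point at most points of
the cone over `dir`. -/
theorem AnalyticGenerated.eventually_const {U A : Set (EuclideanSpace ℝ (Fin 3))} (hU : IsOpen U)
    (h0 : 0 ∈ U) (hA : Subanalytic.AnalyticGenerated U A) :
    ∀ᶠ x in 𝓝[≠] (0 : ℝ), ∀ᶠ y in 𝓝[≠] (0 : ℝ),
      (∀ᶠ p in 𝓝 (y • dir x), p ∈ A) ∨ (∀ᶠ p in 𝓝 (y • dir x), p ∉ A) := by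
  have hcone : ∀ V ∈ 𝓝 (0 : EuclideanSpace ℝ (Fin 3)), ∀ x, ∀ᶠ y in 𝓝[≠] (0 : ℝ), y • dir x ∈ V :=
    fun V hV x => by
      have : Tendsto (fun y : ℝ => y • dir x) (𝓝 0) (𝓝 ((0 : ℝ) • dir x)) :=
        (continuous_id.smul continuous_const).tendsto 0
      rw [zero_smul] at this
      exact (this.eventually hV).filter_mono nhdsWithin_le_nhds
  induction hA with
  | pos g hg =>
    by_cases hz : ∀ᶠ p in 𝓝 0, g p = 0
    · refine .of_forall fun x => (hcone _ (eventually_eventually_nhds.2 hz) x).mono fun y hy => ?_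
      right
      filter_upwards [hy] with p hp hp'
      exact hp'.2.ne' hp
    · filter_upwards [eventually_smul_dir_ne_zero (hg 0 h0) hz] with x hx
      filter_upwards [hx, hcone U (hU.mem_nhds h0) x] with y hy hyU
      have hc := (hg _ hyU).continuousAt
      rcases hy.lt_or_gt with h | h
      · right
        filter_upwards [hc.eventually_lt_const h] with p hp hp'
        exact hp.not_gt hp'.2
      · left
        filter_upwards [hc.eventually_const_lt h, hU.mem_nhds hyU] with p hp hp'
        exact ⟨hp', hp⟩
  | union _ _ ih1 ih2 =>
    filter_upwards [ih1, ih2] with x h1 h2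
    filter_upwards [h1, h2] with y h1 h2
    rcases h1 with h1 | h1
    · exact .inl (h1.mono fun p hp => .inl hp)
    · rcases h2 with h2 | h2
      · exact .inl (h2.mono fun p hp => .inr hp)
      · exact .inr (h1.and h2 |>.mono fun p hp => not_or.2 hp)
  | inter _ _ ih1 ih2 =>
    filter_upwards [ih1, ih2] with x h1 h2
    filter_upwards [h1, h2] with y h1 h2
    rcases h1 with h1 | h1
    · rcases h2 with h2 | h2
      · exact .inl (h1.and h2)
      · exact .inr (h2.mono fun p hp hp' => hp hp'.2)
    · exact .inr (h1.mono fun p hp hp' => hp hp'.1)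
  | compl _ ih =>
    filter_upwards [ih] with x h
    filter_upwards [h, hcone U (hU.mem_nhds h0) x] with y h hyU
    rcases h with h | h
    · exact .inr (h.mono fun p hp hp' => hp'.2 hp)
    · exact .inl ((Filter.eventually_of_mem (hU.mem_nhds hyU) fun _ => id).and h)

end Trefoil

/-! ### The pullback of `fTilde` to the ball, and regularity of `fTilde`. -/

namespace Trefoil

theorem F_zero (ε : ℝ) (p : EuclideanSpace ℝ (Fin 3)) : F ε p 0 =
    p 1 * (Real.exp (p 0) - 1) + p 0 ^ 2 + p 1 ^ 2 + p 2 ^ 2 - ε ^ 2 := rfl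

theorem F_one (ε : ℝ) (p : EuclideanSpace ℝ (Fin 3)) :
    F ε p 1 = p 1 * (Real.exp (p 0 * √2) - 1) := rfl

theorem F_two (ε : ℝ) (p : EuclideanSpace ℝ (Fin 3)) :
    F ε p 2 = p 1 * (Real.exp (p 0 * √3) - 1) := rfl

theorem G_zero (q : EuclideanSpace ℝ (Fin 2)) : G q 0 = q 1 * (Real.exp (q 0 * √2) - 1) := rfl

theorem G_one (q : EuclideanSpace ℝ (Fin 2)) : G q 1 = q 1 * (Real.exp (q 0 * √3) - 1) := rfl

theorem mem_closedBall_three {ε : ℝ} (hε : 0 ≤ ε) {p : EuclideanSpace ℝ (Fin 3)} :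
    p ∈ closedBall 0 ε ↔ p 0 ^ 2 + p 1 ^ 2 + p 2 ^ 2 ≤ ε ^ 2 := by
  rw [mem_closedBall_zero_iff, ← sq_le_sq₀ (norm_nonneg _) hε, EuclideanSpace.real_norm_sq_eq,
    Fin.sum_univ_three]

theorem mem_closedBall_two {ε : ℝ} (hε : 0 ≤ ε) {q : EuclideanSpace ℝ (Fin 2)} :
    q ∈ closedBall 0 ε ↔ q 0 ^ 2 + q 1 ^ 2 ≤ ε ^ 2 := by
  rw [mem_closedBall_zero_iff, ← sq_le_sq₀ (norm_nonneg _) hε, EuclideanSpace.real_norm_sq_eq,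
    Fin.sum_univ_two]

theorem contDiff_F (ε : ℝ) : ContDiff ℝ ∞ (F ε) := by
  rw [contDiff_euclidean]
  intro i
  fin_cases i
  · change ContDiff ℝ ∞ fun p : EuclideanSpace ℝ (Fin 3) =>
      p 1 * (Real.exp (p 0) - 1) + p 0 ^ 2 + p 1 ^ 2 + p 2 ^ 2 - ε ^ 2
    fun_prop
  · change ContDiff ℝ ∞ fun p : EuclideanSpace ℝ (Fin 3) => p 1 * (Real.exp (p 0 * √2) - 1)
    fun_prop
  · change ContDiff ℝ ∞ fun p : EuclideanSpace ℝ (Fin 3) => p 1 * (Real.exp (p 0 * √3) - 1)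
    fun_prop

/-- The pullback of `fTilde` under `F`. -/
noncomputable def pullback (ε : ℝ) (p : EuclideanSpace ℝ (Fin 3)) : ℝ :=
  p 2 ^ 2 * (ε ^ 2 - (p 0 ^ 2 + p 1 ^ 2 + p 2 ^ 2)) * F ε p 1 ^ 2 * F ε p 2 ^ 2

theorem contDiff_pullback (ε : ℝ) : ContDiff ℝ ∞ (pullback ε) := by
  have h := contDiff_euclidean.1 (contDiff_F ε)
  have h1 := h 1
  have h2 := h 2
  unfold pullback
  fun_prop

theorem pullback_nonneg {ε : ℝ} (hε : 0 ≤ ε) {p : EuclideanSpace ℝ (Fin 3)}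
    (hp : p ∈ closedBall 0 ε) : 0 ≤ pullback ε p := by
  have := sub_nonneg.2 ((mem_closedBall_three hε).1 hp)
  unfold pullback
  positivity

theorem F_one_ne_zero {ε : ℝ} {p : EuclideanSpace ℝ (Fin 3)} : F ε p 1 ≠ 0 ↔ p 0 ≠ 0 ∧ p 1 ≠ 0 := by
  rw [F_one, mul_ne_zero_iff]
  constructor
  · rintro ⟨h1, h0⟩
    exact ⟨fun h => by simp [h] at h0, h1⟩
  · exact fun h => ⟨h.2, exp_sqrt_two_sub_one_ne_zero h.1⟩

theorem F_two_ne_zero {ε : ℝ} {p : EuclideanSpace ℝ (Fin 3)} : F ε p 2 ≠ 0 ↔ p 0 ≠ 0 ∧ p 1 ≠ 0 := by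
  rw [F_two, mul_ne_zero_iff]
  constructor
  · rintro ⟨h1, h0⟩
    exact ⟨fun h => by simp [h] at h0, h1⟩
  · exact fun h => ⟨h.2, exp_sqrt_three_sub_one_ne_zero h.1⟩

theorem pullback_pos_iff {ε : ℝ} (hε : 0 ≤ ε) {p : EuclideanSpace ℝ (Fin 3)}
    (hp : p ∈ closedBall 0 ε) : 0 < pullback ε p ↔
      p 0 ≠ 0 ∧ p 1 ≠ 0 ∧ p 2 ≠ 0 ∧ p 0 ^ 2 + p 1 ^ 2 + p 2 ^ 2 ≠ ε ^ 2 := by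
  rw [(pullback_nonneg hε hp).lt_iff_ne', pullback, mul_ne_zero_iff, mul_ne_zero_iff,
    mul_ne_zero_iff, pow_ne_zero_iff two_ne_zero, pow_ne_zero_iff two_ne_zero,
    pow_ne_zero_iff two_ne_zero, F_one_ne_zero, F_two_ne_zero, sub_ne_zero]
  tauto

/-- A kernel vector `w` satisfies two equations from the last components that involve only `w 0` and
`w 1`, with determinant nonzero by `jacobian_pos`. Both coordinates vanish, and the first component
leaves `2 * p 2 * w 2 = 0`. -/
theorem exists_hasFDerivAt_F {ε : ℝ} {p : EuclideanSpace ℝ (Fin 3)} (h0 : p 0 ≠ 0) (h1 : p 1 ≠ 0)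
    (h2 : p 2 ≠ 0) : ∃ L : EuclideanSpace ℝ (Fin 3) ≃L[ℝ] EuclideanSpace ℝ (Fin 3),
      HasFDerivAt (F ε) (L : EuclideanSpace ℝ (Fin 3) →L[ℝ] EuclideanSpace ℝ (Fin 3)) p := by
  have hd : HasFDerivAt (F ε) (fderiv ℝ (F ε) p) p :=
    ((contDiff_F ε).differentiable (by simp) p).hasFDerivAt
  set L := fderiv ℝ (F ε) p
  have hinj : Function.Injective L := by
    rw [injective_iff_map_eq_zero]
    intro w hw
    have hl : HasDerivAt (fun t : ℝ => F ε (p + t • w)) 0 0 := by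
      have hc : HasDerivAt (fun t : ℝ => p + t • w) w 0 := by
        simpa using ((hasDerivAt_id (0 : ℝ)).smul_const w).const_add p
      have hd' : HasFDerivAt (F ε) L (p + (0 : ℝ) • w) := by simpa using hd
      exact (hd'.comp_hasDerivAt 0 hc).congr_deriv hw
    have hcomp : ∀ i, HasDerivAt (fun t : ℝ => F ε (p + t • w) i) 0 0 := fun i => by
      exact ((EuclideanSpace.proj (𝕜 := ℝ) i).hasFDerivAt.comp_hasDerivAt 0 hl).congr_deriv
        (map_zero _)
    have hlin : ∀ i, HasDerivAt (fun t : ℝ => (p + t • w) i) (w i) 0 := fun i => by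
      simpa using ((hasDerivAt_id (0 : ℝ)).mul_const (w i)).const_add (p i)
    have hexp : ∀ c : ℝ, HasDerivAt
        (fun t : ℝ => (p + t • w) 1 * (Real.exp ((p + t • w) 0 * c) - 1))
        (w 1 * (Real.exp (p 0 * c) - 1) + p 1 * (Real.exp (p 0 * c) * (w 0 * c))) 0 := fun c => by
      refine ((hlin 1).mul ((((hlin 0).mul_const c).exp).sub_const 1)).congr_deriv ?_
      simp
    have e2 := (hexp √2).unique (hcomp 1)
    have e3 := (hexp √3).unique (hcomp 2)
    have hJ := jacobian_pos h0
    have hw0 : w 0 = 0 := by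
      have : w 0 * (p 1 * (√3 * Real.exp (p 0 * √3) * (Real.exp (p 0 * √2) - 1) -
          √2 * Real.exp (p 0 * √2) * (Real.exp (p 0 * √3) - 1))) = 0 := by
        linear_combination (Real.exp (p 0 * √2) - 1) * e3 - (Real.exp (p 0 * √3) - 1) * e2
      exact (mul_eq_zero.1 this).resolve_right (mul_ne_zero h1 (sub_ne_zero.2 hJ.ne'))
    have hw1 : w 1 = 0 := by
      rw [hw0] at e2
      have : w 1 * (Real.exp (p 0 * √2) - 1) = 0 := by linear_combination e2
      exact (mul_eq_zero.1 this).resolve_right (exp_sqrt_two_sub_one_ne_zero h0)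
    have hF0 : HasDerivAt (fun t : ℝ => F ε (p + t • w) 0) (2 * p 2 * w 2) 0 := by
      have := ((((hexp 1).add ((hlin 0).pow 2)).add ((hlin 1).pow 2)).add
        ((hlin 2).pow 2)).sub_const (ε ^ 2)
      simp only [mul_one] at this
      refine this.congr_deriv ?_
      simp [hw0, hw1]
    have hw2 : w 2 = 0 := by
      have := hF0.unique (hcomp 0)
      simpa [h2] using this
    ext i
    fin_cases i
    exacts [hw0, hw1, hw2]
  refine ⟨(LinearEquiv.ofInjectiveEndo L.toLinearMap hinj).toContinuousLinearEquiv, ?_⟩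
  convert hd
  ext1 w
  rfl

theorem F_mem_Omega {ε : ℝ} (hε : 0 ≤ ε) {p : EuclideanSpace ℝ (Fin 3)}
    (hp : p ∈ closedBall 0 ε) (h : 0 < pullback ε p) : F ε p ∈ Omega ε := by
  obtain ⟨h0, h1, h2, hne⟩ := (pullback_pos_iff hε hp).1 h
  obtain ⟨L, hL⟩ := exists_hasFDerivAt_F (ε := ε) h0 h1 h2
  have hs := (contDiff_F ε).contDiffAt.hasStrictFDerivAt' hL (by simp)
  have hn : closedBall 0 ε ∈ 𝓝 p := by
    have hlt := lt_of_le_of_ne ((mem_closedBall_three hε).1 hp) hne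
    refine closedBall_mem_nhds_of_mem ?_
    rwa [mem_ball_zero_iff, ← sq_lt_sq₀ (norm_nonneg _) hε, EuclideanSpace.real_norm_sq_eq,
      Fin.sum_univ_three]
  rw [Omega, mem_interior_iff_mem_nhds, ← hs.map_nhds_eq_of_equiv]
  exact Filter.image_mem_map hn

theorem coords_eq_of_F_eq {ε : ℝ} {p p' : EuclideanSpace ℝ (Fin 3)} (h0 : p 0 ≠ 0) (h1 : p 1 ≠ 0)
    (e1 : F ε p 1 = F ε p' 1) (e2 : F ε p 2 = F ε p' 2) : p 0 = p' 0 ∧ p 1 = p' 1 :=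
  eq_of_components_eq h0 h1 e1 e2

/-- From an interior point one can move inside the image of the ball in every direction. -/
theorem exists_pos_of_mem_Omega {ε : ℝ} {P : EuclideanSpace ℝ (Fin 3)} (hP : P ∈ Omega ε)
    (d : EuclideanSpace ℝ (Fin 3)) :
    ∃ t : ℝ, 0 < t ∧ ∃ p ∈ closedBall 0 ε, F ε p = P + t • d := by
  have ht : Filter.Tendsto (fun t : ℝ => P + t • d) (𝓝 0) (𝓝 (P + (0 : ℝ) • d)) :=
    (continuous_const.add (continuous_id.smul continuous_const)).tendsto 0
  rw [zero_smul, add_zero] at ht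
  have hev := ht.eventually (mem_interior_iff_mem_nhds.1 hP)
  obtain ⟨t, ht, h0⟩ := ((hev.filter_mono (nhdsWithin_le_nhds (s := Ioi 0))).and
    self_mem_nhdsWithin).exists
  exact ⟨t, h0, ht⟩

/-- Wherever `pullback` vanishes, some direction leaves the image. If `x = 0` or `y = 0`, then `v =
w = 0`, and raising `w` alone reaches points with `v = 0 ≠ w`, which are never attained. If `z = 0`,
then `u` is minimal on its fibre; on the sphere it is maximal. -/
theorem exists_of_mem_Omega {ε : ℝ} (hε : 0 ≤ ε) {P : EuclideanSpace ℝ (Fin 3)}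
    (hP : P ∈ Omega ε) : ∃ p ∈ closedBall 0 ε, F ε p = P ∧ 0 < pullback ε p := by
  obtain ⟨p, hp, rfl⟩ := interior_subset hP
  refine ⟨p, hp, rfl, (pullback_pos_iff hε hp).2 ?_⟩
  have h01 : p 0 ≠ 0 ∧ p 1 ≠ 0 := by
    by_contra hcon
    have hv := not_not.1 (mt (F_one_ne_zero (ε := ε)).1 hcon)
    have hw := not_not.1 (mt (F_two_ne_zero (ε := ε)).1 hcon)
    obtain ⟨t, ht, p', -, hp'⟩ := exists_pos_of_mem_Omega hP (EuclideanSpace.single 2 1)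
    have hv' : F ε p' 1 = 0 := by rw [hp']; simp [hv]
    have hw' : F ε p' 2 = t := by rw [hp']; simp [hw]
    exact F_one_ne_zero.2 (F_two_ne_zero.1 (hw' ▸ ht.ne')) hv'
  refine ⟨h01.1, h01.2, fun hz => ?_, fun hz => ?_⟩
  · obtain ⟨t, ht, p', -, hp'⟩ := exists_pos_of_mem_Omega hP (-EuclideanSpace.single 0 1)
    obtain ⟨hx, hy⟩ := coords_eq_of_F_eq (ε := ε) (p' := p') h01.1 h01.2
      (by rw [hp']; simp) (by rw [hp']; simp)
    have e : F ε p' 0 = F ε p 0 - t := by rw [hp']; simp [sub_eq_add_neg]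
    rw [F_zero, F_zero, ← hx, ← hy, hz] at e
    nlinarith [sq_nonneg (p' 2)]
  · obtain ⟨t, ht, p', hb, hp'⟩ := exists_pos_of_mem_Omega hP (EuclideanSpace.single 0 1)
    obtain ⟨hx, hy⟩ := coords_eq_of_F_eq (ε := ε) (p' := p') h01.1 h01.2
      (by rw [hp']; simp) (by rw [hp']; simp)
    have e : F ε p' 0 = F ε p 0 + t := by rw [hp']; simp
    have hb' := (mem_closedBall_three hε).1 hb
    rw [F_zero, F_zero, ← hx, ← hy] at e
    rw [← hx, ← hy] at hb'
    linarith

theorem fTilde_of_notMem {ε : ℝ} {P : EuclideanSpace ℝ (Fin 3)} (hP : P ∉ Omega ε) :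
    fTilde ε P = 0 := by
  simp [fTilde, f, hP]

theorem G_eq_of_F (ε : ℝ) (p : EuclideanSpace ℝ (Fin 3)) :
    G !₂[p 0, p 1] = !₂[F ε p 1, F ε p 2] := rfl

theorem mem_closedBall_two_of_three {ε : ℝ} (hε : 0 ≤ ε) {p : EuclideanSpace ℝ (Fin 3)}
    (hp : p ∈ closedBall 0 ε) : !₂[p 0, p 1] ∈ closedBall (0 : EuclideanSpace ℝ (Fin 2)) ε := by
  rw [mem_closedBall_two hε]
  have := (mem_closedBall_three hε).1 hp
  simp
  nlinarith [sq_nonneg (p 2)]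

theorem Ginv_F {ε : ℝ} (hε : 0 ≤ ε) {p : EuclideanSpace ℝ (Fin 3)} (hp : p ∈ closedBall 0 ε)
    (h0 : p 0 ≠ 0) (h1 : p 1 ≠ 0) : Ginv ε !₂[F ε p 1, F ε p 2] = !₂[p 0, p 1] := by
  have hex : ∃ q ∈ closedBall (0 : EuclideanSpace ℝ (Fin 2)) ε, G q = !₂[F ε p 1, F ε p 2] :=
    ⟨_, mem_closedBall_two_of_three hε hp, G_eq_of_F ε p⟩
  have hG : G (Ginv ε !₂[F ε p 1, F ε p 2]) = !₂[F ε p 1, F ε p 2] := Function.invFunOn_eq hex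
  obtain ⟨hx, hy⟩ := eq_of_components_eq h0 h1
    (congrArg (fun q : EuclideanSpace ℝ (Fin 2) => q 0) hG).symm
    (congrArg (fun q : EuclideanSpace ℝ (Fin 2) => q 1) hG).symm
  ext i
  fin_cases i
  exacts [hx.symm, hy.symm]

/-- On the fibre, `ψ - u = ε² - (x² + y² + z²)` and `u - ψ - φ + ε² = z²`. Outside `Omega` both
sides are zero, since a positive `pullback` would put the image in `Omega`. -/
theorem fTilde_F {ε : ℝ} (hε : 0 ≤ ε) {p : EuclideanSpace ℝ (Fin 3)} (hp : p ∈ closedBall 0 ε) :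
    fTilde ε (F ε p) = pullback ε p := by
  by_cases hΩ : F ε p ∈ Omega ε
  · obtain ⟨p', hp', he, hpos⟩ := exists_of_mem_Omega hε hΩ
    obtain ⟨h0, h1, -⟩ := (pullback_pos_iff hε hp').1 hpos
    -- Nonvanishing of `v` depends only on the image point, so it passes from `p'` to the given
    -- preimage `p`.
    have h01 := F_one_ne_zero.1 (he ▸ F_one_ne_zero.2 ⟨h0, h1⟩)
    have hnorm : ‖!₂[p 0, p 1]‖ ^ 2 = p 0 ^ 2 + p 1 ^ 2 := by
      rw [EuclideanSpace.real_norm_sq_eq, Fin.sum_univ_two]; rfl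
    simp only [fTilde, f, indicator_of_mem hΩ, psi, phi, Ginv_F hε hp h01.1 h01.2, hnorm, pullback,
      F_zero]
    simp only [Matrix.cons_val_zero, Matrix.cons_val_one]
    ring
  · rw [fTilde_of_notMem hΩ]
    exact ((pullback_nonneg hε hp).eq_or_lt).resolve_right fun h => hΩ (F_mem_Omega hε hp h)

theorem fTilde_nonneg {ε : ℝ} (hε : 0 ≤ ε) (P : EuclideanSpace ℝ (Fin 3)) : 0 ≤ fTilde ε P := by
  by_cases hΩ : P ∈ Omega ε
  · obtain ⟨p, hp, rfl, h⟩ := exists_of_mem_Omega hε hΩ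
    rw [fTilde_F hε hp]
    exact h.le
  · exact (fTilde_of_notMem hΩ).ge

theorem Omega_eq {ε : ℝ} (hε : 0 ≤ ε) : Omega ε = {P | 0 < fTilde ε P} := by
  ext P
  constructor
  · intro hΩ
    obtain ⟨p, hp, rfl, h⟩ := exists_of_mem_Omega hε hΩ
    rwa [mem_ofPred, fTilde_F hε hp]
  · intro h
    by_contra hΩ
    exact h.ne' (fTilde_of_notMem hΩ)

/-- The preimage of a closed set `C` is the compact image of a closed part of the ball, together
with the closed complement of `Omega` when `0 ∈ C`. -/
theorem continuous_fTilde {ε : ℝ} (hε : 0 ≤ ε) : Continuous (fTilde ε) := by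
  rw [continuous_iff_isClosed]
  intro C hC
  have himg : IsClosed (F ε '' (closedBall 0 ε ∩ pullback ε ⁻¹' C)) :=
    (((isCompact_closedBall _ _).inter_right (hC.preimage (contDiff_pullback ε).continuous)).image
      (contDiff_F ε).continuous).isClosed
  have hΩ : IsClosed (Omega ε)ᶜ := isOpen_interior.isClosed_compl
  have hsub : ∀ P ∈ Omega ε, P ∈ fTilde ε ⁻¹' C →
      P ∈ F ε '' (closedBall 0 ε ∩ pullback ε ⁻¹' C) := fun P hP h => by
    obtain ⟨p, hp, rfl, -⟩ := exists_of_mem_Omega hε hP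
    exact ⟨p, ⟨hp, by rwa [mem_preimage, fTilde_F hε hp] at h⟩, rfl⟩
  have hsup : F ε '' (closedBall 0 ε ∩ pullback ε ⁻¹' C) ⊆ fTilde ε ⁻¹' C := by
    rintro _ ⟨p, ⟨hp, h⟩, rfl⟩
    rwa [mem_preimage, fTilde_F hε hp]
  by_cases h0 : (0 : ℝ) ∈ C
  · convert himg.union hΩ using 1
    refine Subset.antisymm (fun P h => ?_) (union_subset hsup fun P h => ?_)
    · by_cases hP : P ∈ Omega ε
      · exact .inl (hsub P hP h)
      · exact .inr hP
    · rwa [mem_preimage, fTilde_of_notMem h]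
  · convert himg using 1
    refine Subset.antisymm (fun P h => hsub P ?_ h) hsup
    by_contra hP
    rw [mem_preimage, fTilde_of_notMem hP] at h
    exact h0 h

theorem contDiffOn_fTilde {ε : ℝ} (hε : 0 ≤ ε) :
    ContDiffOn ℝ ∞ (fTilde ε) (frontier (Omega ε))ᶜ := by
  intro P hP
  refine ContDiffAt.contDiffWithinAt ?_
  by_cases hΩ : P ∈ Omega ε
  · obtain ⟨p, hp, rfl, h⟩ := exists_of_mem_Omega hε hΩ
    obtain ⟨h0, h1, h2, hne⟩ := (pullback_pos_iff hε hp).1 h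
    obtain ⟨L, hL⟩ := exists_hasFDerivAt_F (ε := ε) h0 h1 h2
    have hF : ContDiffAt ℝ ∞ (F ε) p := (contDiff_F ε).contDiffAt
    have hinv := hF.to_localInverse hL (by simp)
    have happ : hF.localInverse hL (by simp) (F ε p) = p := hF.localInverse_apply_image hL (by simp)
    have hright := (hF.hasStrictFDerivAt' hL (by simp)).eventually_right_inverse
    have hcomp : ContDiffAt ℝ ∞ (fun Q => pullback ε (hF.localInverse hL (by simp) Q)) (F ε p) :=
      (contDiff_pullback ε).contDiffAt.comp _ hinv
    refine hcomp.congr_of_eventuallyEq ?_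
    have hn : closedBall 0 ε ∈ 𝓝 p := by
      have hlt := lt_of_le_of_ne ((mem_closedBall_three hε).1 hp) hne
      refine closedBall_mem_nhds_of_mem ?_
      rwa [mem_ball_zero_iff, ← sq_lt_sq₀ (norm_nonneg _) hε, EuclideanSpace.real_norm_sq_eq,
        Fin.sum_univ_three]
    have htend : Filter.Tendsto (hF.localInverse hL (by simp)) (𝓝 (F ε p)) (𝓝 p) := by
      simpa only [ContinuousAt, happ] using hinv.continuousAt
    filter_upwards [hright, htend.eventually hn] with Q hQ hQb
    rw [← fTilde_F hε hQb]
    exact congrArg _ hQ.symm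
  · have hcl : P ∉ closure (Omega ε) := fun h =>
      hP ⟨h, fun h' => hΩ (interior_subset h')⟩
    have : fTilde ε =ᶠ[𝓝 P] fun _ => 0 := by
      filter_upwards [isClosed_closure.isOpen_compl.mem_nhds hcl] with Q hQ
      exact fTilde_of_notMem fun h => hQ (subset_closure h)
    exact contDiffAt_const.congr_of_eventuallyEq this

theorem existsUnique_preimage {ε : ℝ} (r : EuclideanSpace ℝ (Fin 2)) (hr : r ∈ Gam ε \ {0}) :
    ∃! q : EuclideanSpace ℝ (Fin 2), q ∈ closedBall 0 ε ∧ G q = r := by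
  obtain ⟨⟨q, hq, rfl⟩, hne⟩ := hr
  have h0 : q 0 ≠ 0 := fun h => hne <| by
    ext i; fin_cases i <;> simp [G_zero, G_one, h]
  have h1 : q 1 ≠ 0 := fun h => hne <| by
    ext i; fin_cases i <;> simp [G_zero, G_one, h]
  refine ⟨q, ⟨hq, rfl⟩, ?_⟩
  rintro q' ⟨-, he⟩
  obtain ⟨hx, hy⟩ := eq_of_components_eq h0 h1
    (congrArg (fun q : EuclideanSpace ℝ (Fin 2) => q 0) he).symm
    (congrArg (fun q : EuclideanSpace ℝ (Fin 2) => q 1) he).symm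
  ext i
  fin_cases i
  exacts [hx.symm, hy.symm]

theorem mem_Gam_of_mem_Omega {ε : ℝ} (hε : 0 ≤ ε) (P : EuclideanSpace ℝ (Fin 3))
    (hP : P ∈ Omega ε) : !₂[P 1, P 2] ∈ Gam ε \ {0} := by
  obtain ⟨p, hp, rfl, h⟩ := exists_of_mem_Omega hε hP
  obtain ⟨h0, h1, -⟩ := (pullback_pos_iff hε hp).1 h
  refine ⟨⟨_, mem_closedBall_two_of_three hε hp, G_eq_of_F ε p⟩, fun h => ?_⟩
  have hv : F ε p 1 = 0 :=
    congrArg (fun q : EuclideanSpace ℝ (Fin 2) => q 0) (mem_singleton_iff.1 h)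
  exact F_one_ne_zero.2 ⟨h0, h1⟩ hv

/-! ### Failure of semianalyticity at the origin. -/

/-- For small nonzero `x`, `y` the point `y • dir x` is the image of a point of the sphere, so it is
not in `Omega`, while points just below it in the `u` direction are. This contradicts local
constancy of membership along the cone. -/
theorem not_isSemianalytic_Omega {ε : ℝ} (hε : 0 < ε) : ¬ Subanalytic.IsSemianalytic (Omega ε) := by
  intro hs
  obtain ⟨U, hU, h0, hA⟩ := hs 0
  have hev := AnalyticGenerated.eventually_const hU h0 hA
  have hx0 : ∀ᶠ x in 𝓝[≠] (0 : ℝ), x ≠ 0 ∧ x ^ 2 < ε ^ 2 := by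
    refine Filter.Eventually.and self_mem_nhdsWithin
      (Filter.Eventually.filter_mono nhdsWithin_le_nhds ?_)
    exact (continuous_pow 2).continuousAt.eventually_lt_const (by simpa using pow_pos hε 2)
  obtain ⟨x, hx, hxne, hxε⟩ := (hev.and hx0).exists
  have hyU : ∀ᶠ y in 𝓝[≠] (0 : ℝ), y • dir x ∈ U := by
    have : Filter.Tendsto (fun y : ℝ => y • dir x) (𝓝 0) (𝓝 ((0 : ℝ) • dir x)) :=
      (continuous_id.smul continuous_const).tendsto 0
    rw [zero_smul] at this
    exact (this.eventually (hU.mem_nhds h0)).filter_mono nhdsWithin_le_nhds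
  have hy0 : ∀ᶠ y in 𝓝[≠] (0 : ℝ), y ≠ 0 ∧ x ^ 2 + y ^ 2 < ε ^ 2 := by
    refine Filter.Eventually.and self_mem_nhdsWithin
      (Filter.Eventually.filter_mono nhdsWithin_le_nhds ?_)
    have hc : ContinuousAt (fun y : ℝ => x ^ 2 + y ^ 2) 0 := by fun_prop
    exact hc.eventually_lt_const (by simpa using hxε)
  obtain ⟨y, ⟨hy, hyU⟩, hyne, hyε⟩ := ((hx.and hyU).and hy0).exists
  have hcomp : ∀ z, z ^ 2 = ε ^ 2 - x ^ 2 - y ^ 2 → F ε !₂[x, y, z] = y • dir x := fun z hz => by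
    ext i
    fin_cases i
    · simp [F_zero, dir]; linarith
    · simp [F_one, dir]
    · simp [F_two, dir]
  have hline : ∀ᶠ t in 𝓝[>] (0 : ℝ),
      y • dir x - t • EuclideanSpace.single 0 1 ∈ Omega ε := by
    have hpos : 0 < ε ^ 2 - x ^ 2 - y ^ 2 := by linarith
    filter_upwards [Ioo_mem_nhdsGT hpos] with t ht
    have hsq : √(ε ^ 2 - x ^ 2 - y ^ 2 - t) ^ 2 = ε ^ 2 - x ^ 2 - y ^ 2 - t :=
      Real.sq_sqrt (by linarith [ht.2])
    have hFp : F ε !₂[x, y, √(ε ^ 2 - x ^ 2 - y ^ 2 - t)] =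
        y • dir x - t • EuclideanSpace.single 0 1 := by
      ext i
      fin_cases i
      · simp [F_zero, dir, hsq]; ring
      · simp [F_one, dir]
      · simp [F_two, dir]
    have hb : !₂[x, y, √(ε ^ 2 - x ^ 2 - y ^ 2 - t)] ∈
        closedBall (0 : EuclideanSpace ℝ (Fin 3)) ε := by
      rw [mem_closedBall_three hε.le]
      simp [hsq]; linarith [ht.1]
    rw [← hFp]
    refine F_mem_Omega hε.le hb ((pullback_pos_iff hε.le hb).2 ⟨hxne, hyne, ?_, ?_⟩)
    · simpa using (Real.sqrt_pos.2 (by linarith [ht.2])).ne'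
    · simp [hsq]; linarith [ht.1]
  have hnot : y • dir x ∉ Omega ε := fun hΩ => by
    have hsq : √(ε ^ 2 - x ^ 2 - y ^ 2) ^ 2 = ε ^ 2 - x ^ 2 - y ^ 2 :=
      Real.sq_sqrt (by linarith)
    have hb : !₂[x, y, √(ε ^ 2 - x ^ 2 - y ^ 2)] ∈
        closedBall (0 : EuclideanSpace ℝ (Fin 3)) ε := by
      rw [mem_closedBall_three hε.le]
      simp [hsq]
    rw [Omega_eq hε.le, mem_ofPred, ← hcomp _ hsq, fTilde_F hε.le hb, pullback_pos_iff hε.le hb] at hΩ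
    exact hΩ.2.2.2 (by simp [hsq])
  rcases hy with h | h
  · exact hnot h.self_of_nhds.1
  · have ht : Filter.Tendsto (fun t : ℝ => y • dir x - t • EuclideanSpace.single (0 : Fin 3) (1 : ℝ))
        (𝓝 0) (𝓝 (y • dir x - (0 : ℝ) • EuclideanSpace.single (0 : Fin 3) (1 : ℝ))) :=
      (continuous_const.sub (continuous_id.smul continuous_const)).tendsto 0
    rw [zero_smul, sub_zero] at ht
    have hev' := (ht.eventually (h.and (hU.mem_nhds hyU))).filter_mono
      (nhdsWithin_le_nhds (s := Ioi 0))
    obtain ⟨t, h1, h2, h3⟩ := (hline.and hev').exists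
    exact h2 ⟨h1, h3⟩

end Trefoil

/-! ### Closure properties of sets described by globally analytic functions. -/

namespace Subanalytic

variable {W : Type*} [NormedAddCommGroup W] [NormedSpace ℝ W]

theorem AnalyticGenerated.lt {g h : W → ℝ} (hg : ∀ X, AnalyticAt ℝ g X)
    (hh : ∀ X, AnalyticAt ℝ h X) :
    AnalyticGenerated univ {X | g X < h X} := by
  simpa using AnalyticGenerated.pos (U := univ) (fun X => h X - g X) fun X _ => (hh X).sub (hg X)

theorem AnalyticGenerated.not {P : W → Prop} (hP : AnalyticGenerated univ {X | P X}) :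
    AnalyticGenerated univ {X | ¬ P X} := by
  have := hP.compl
  rwa [← compl_eq_univ_sdiff] at this

theorem AnalyticGenerated.and {P Q : W → Prop} (hP : AnalyticGenerated univ {X | P X})
    (hQ : AnalyticGenerated univ {X | Q X}) : AnalyticGenerated univ {X | P X ∧ Q X} :=
  hP.inter hQ

theorem AnalyticGenerated.or {P Q : W → Prop} (hP : AnalyticGenerated univ {X | P X})
    (hQ : AnalyticGenerated univ {X | Q X}) : AnalyticGenerated univ {X | P X ∨ Q X} :=
  hP.union hQ

theorem AnalyticGenerated.le {g h : W → ℝ} (hg : ∀ X, AnalyticAt ℝ g X)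
    (hh : ∀ X, AnalyticAt ℝ h X) :
    AnalyticGenerated univ {X | g X ≤ h X} := by
  simpa only [not_lt] using (AnalyticGenerated.lt hh hg).not

theorem AnalyticGenerated.eq {g h : W → ℝ} (hg : ∀ X, AnalyticAt ℝ g X)
    (hh : ∀ X, AnalyticAt ℝ h X) :
    AnalyticGenerated univ {X | g X = h X} := by
  simpa only [le_antisymm_iff] using (AnalyticGenerated.le hg hh).and (.le hh hg)

theorem AnalyticGenerated.isSemianalytic {S : Set W} (h : AnalyticGenerated univ S) :
    IsSemianalytic S := fun _ => ⟨univ, isOpen_univ, mem_univ _, by rwa [inter_univ]⟩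

end Subanalytic

/-! ### The graph of `fTilde` as a projection. -/

namespace Trefoil

/-- An analytic condition on `(u, v, w, t)` and auxiliary variables `(x, y, z)` from the ball of
radius `ε` whose projection is the graph `t = fTilde ε (u, v, w)`. -/
def GraphCond (ε u v w t x y z : ℝ) : Prop :=
  (t = 0 ∧ (v * √3 = w * √2 ∨
    (v * (Real.exp (ε * √3) - 1) - w * (Real.exp (ε * √2) - 1)) *
      (v * (Real.exp (-ε * √3) - 1) - w * (Real.exp (-ε * √2) - 1)) < 0 ∨
    (¬ x = 0 ∧ v * (Real.exp (x * √3) - 1) = w * (Real.exp (x * √2) - 1) ∧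
      ε ^ 2 * (Real.exp (x * √2) - 1) ^ 2 < x ^ 2 * (Real.exp (x * √2) - 1) ^ 2 + v ^ 2) ∨
    (¬ v = 0 ∧ v = y * (Real.exp (x * √2) - 1) ∧ w = y * (Real.exp (x * √3) - 1) ∧
      (y * (Real.exp x - 1) < u ∨ u < y * (Real.exp x - 1) + x ^ 2 + y ^ 2 - ε ^ 2)))) ∨
  (u = y * (Real.exp x - 1) + x ^ 2 + y ^ 2 + z ^ 2 - ε ^ 2 ∧ v = y * (Real.exp (x * √2) - 1) ∧
    w = y * (Real.exp (x * √3) - 1) ∧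
    t = z ^ 2 * (ε ^ 2 - (x ^ 2 + y ^ 2 + z ^ 2)) * v ^ 2 * w ^ 2)

theorem analyticGenerated_graphCond {W : Type*} [NormedAddCommGroup W] [NormedSpace ℝ W] (ε : ℝ)
    {u v w t x y z : W → ℝ} (hu : ∀ X, AnalyticAt ℝ u X) (hv : ∀ X, AnalyticAt ℝ v X)
    (hw : ∀ X, AnalyticAt ℝ w X) (ht : ∀ X, AnalyticAt ℝ t X) (hx : ∀ X, AnalyticAt ℝ x X)
    (hy : ∀ X, AnalyticAt ℝ y X) (hz : ∀ X, AnalyticAt ℝ z X) :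
    Subanalytic.AnalyticGenerated univ
      {X | GraphCond ε (u X) (v X) (w X) (t X) (x X) (y X) (z X)} := by
  unfold GraphCond
  refine .or (.and (.eq ?_ ?_) (.or (.eq ?_ ?_) (.or (.lt ?_ ?_) (.or
    (.and (.not (.eq ?_ ?_)) (.and (.eq ?_ ?_) (.lt ?_ ?_)))
    (.and (.not (.eq ?_ ?_)) (.and (.eq ?_ ?_) (.and (.eq ?_ ?_)
      (.or (.lt ?_ ?_) (.lt ?_ ?_)))))))))
    (.and (.eq ?_ ?_) (.and (.eq ?_ ?_) (.and (.eq ?_ ?_) (.eq ?_ ?_)))) <;>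
  · intro X
    have := hu X
    have := hv X
    have := hw X
    have := ht X
    have := hx X
    have := hy X
    have := hz X
    fun_prop

theorem exists_coords_of_fTilde_ne_zero {ε : ℝ} (hε : 0 ≤ ε) {P : EuclideanSpace ℝ (Fin 3)}
    (h : fTilde ε P ≠ 0) : ∃ x y : ℝ, x ≠ 0 ∧ y ≠ 0 ∧ x ^ 2 + y ^ 2 ≤ ε ^ 2 ∧
      P 1 = y * (Real.exp (x * √2) - 1) ∧ P 2 = y * (Real.exp (x * √3) - 1) ∧
      P 0 ≤ y * (Real.exp x - 1) ∧ y * (Real.exp x - 1) + x ^ 2 + y ^ 2 - ε ^ 2 ≤ P 0 := by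
  have hΩ : P ∈ Omega ε := by
    by_contra hΩ
    exact h (fTilde_of_notMem hΩ)
  obtain ⟨p, hp, rfl, hpos⟩ := exists_of_mem_Omega hε hΩ
  obtain ⟨h0, h1, -⟩ := (pullback_pos_iff hε hp).1 hpos
  have hb := (mem_closedBall_three hε).1 hp
  have hz := sq_nonneg (p 2)
  refine ⟨p 0, p 1, h0, h1, by linarith, rfl, rfl, ?_, ?_⟩ <;> rw [F_zero] <;> linarith

/-- Each alternative with `t = 0` excludes a nonzero value: `(v, w)` lies on the tangent line at `x
= 0`, or outside the cone swept for `|x| ≤ ε`, or its unique preimage under `G` lies outside the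
disc, or `u` is off the segment. In the third case `y` may be large, so it is eliminated as `v /
(e^{√2 x} - 1)`, which keeps the auxiliary variables bounded. -/
theorem fTilde_eq_of_graphCond {ε t : ℝ} (hε : 0 < ε) {P p : EuclideanSpace ℝ (Fin 3)}
    (hp : p ∈ closedBall 0 ε) (h : GraphCond ε (P 0) (P 1) (P 2) t (p 0) (p 1) (p 2)) :
    t = fTilde ε P := by
  rcases h with ⟨rfl, h⟩ | ⟨h0, h1, h2, rfl⟩
  · by_contra hne
    obtain ⟨x, y, hx, hy, hxy, hv, hw, hu1, hu2⟩ :=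
      exists_coords_of_fTilde_ne_zero hε.le (Ne.symm hne)
    have hA := exp_sqrt_two_sub_one_ne_zero hx
    have hv0 : P 1 ≠ 0 := hv ▸ mul_ne_zero hy hA
    rcases h with h | h | ⟨h0, h1, h2⟩ | ⟨-, h1, h2, h3⟩
    · rw [hv, hw] at h
      refine (sqrt_three_mul_exp_lt hx).ne (mul_left_cancel₀ hy ?_)
      linear_combination h
    · rw [hv, hw] at h
      have hx2 : x ^ 2 ≤ ε ^ 2 := by nlinarith [sq_nonneg y]
      obtain ⟨hl, hr⟩ := abs_le.1 (abs_le_of_sq_le_sq hx2 hε.le)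
      exact (mul_components_nonneg y hε hx hl hr).not_gt h
    · have hA' := exp_sqrt_two_sub_one_ne_zero h0
      obtain ⟨rfl, hy'⟩ := eq_of_components_eq (x := x) (y := y) (x' := p 0)
        (y' := P 1 / (Real.exp (p 0 * √2) - 1)) hx hy
        (by rw [← hv]; field_simp)
        (by rw [← hw, div_mul_eq_mul_div, h1]; field_simp)
      rw [hv] at h2
      nlinarith [mul_le_mul_of_nonneg_right hxy (sq_nonneg (Real.exp (p 0 * √2) - 1))]
    · obtain ⟨rfl, rfl⟩ := eq_of_components_eq hx hy (hv.symm.trans h1) (hw.symm.trans h2)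
      rcases h3 with h3 | h3 <;> linarith
  · have hP : P = F ε p := by
      ext i
      fin_cases i
      exacts [h0, h1, h2]
    rw [hP, fTilde_F hε.le hp]
    rfl

theorem exists_graphCond {ε : ℝ} (hε : 0 < ε) (P : EuclideanSpace ℝ (Fin 3)) :
    ∃ p ∈ closedBall (0 : EuclideanSpace ℝ (Fin 3)) ε,
      GraphCond ε (P 0) (P 1) (P 2) (fTilde ε P) (p 0) (p 1) (p 2) := by
  -- Any `t` will do, because `fTilde_eq_of_graphCond` forces its value.
  suffices h : ∃ x y z t : ℝ, x ^ 2 + y ^ 2 + z ^ 2 ≤ ε ^ 2 ∧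
      GraphCond ε (P 0) (P 1) (P 2) t x y z by
    obtain ⟨x, y, z, t, hb, h⟩ := h
    have hp : !₂[x, y, z] ∈ closedBall (0 : EuclideanSpace ℝ (Fin 3)) ε :=
      (mem_closedBall_three hε.le).2 hb
    obtain rfl := fTilde_eq_of_graphCond hε hp h
    exact ⟨_, hp, h⟩
  by_cases h23 : P 1 * √3 = P 2 * √2
  · exact ⟨0, 0, 0, 0, by simpa using sq_nonneg ε, .inl ⟨rfl, .inl h23⟩⟩
  rcases lt_or_ge ((P 1 * (Real.exp (ε * √3) - 1) - P 2 * (Real.exp (ε * √2) - 1)) *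
      (P 1 * (Real.exp (-ε * √3) - 1) - P 2 * (Real.exp (-ε * √2) - 1))) 0 with hk | hk
  · exact ⟨0, 0, 0, 0, by simpa using sq_nonneg ε, .inl ⟨rfl, .inr (.inl hk)⟩⟩
  obtain ⟨x, hx, hl, hr, hk⟩ := exists_zero_of_mul_nonneg hε h23 hk
  have hA := exp_sqrt_two_sub_one_ne_zero hx
  have hk' := sub_eq_zero.1 hk
  have hv0 : P 1 ≠ 0 := fun h => by
    rw [h, zero_mul, eq_comm, mul_eq_zero] at hk'
    exact h23 (by rw [h, hk'.resolve_right hA]; ring)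
  obtain ⟨y, hy⟩ : ∃ y, P 1 = y * (Real.exp (x * √2) - 1) :=
    ⟨P 1 / (Real.exp (x * √2) - 1), by field_simp⟩
  have hw : P 2 = y * (Real.exp (x * √3) - 1) := by
    refine mul_right_cancel₀ hA ?_
    rw [← hk', hy]; ring
  have hx2 : x ^ 2 ≤ ε ^ 2 := sq_le_sq' hl hr
  by_cases hxy : x ^ 2 + y ^ 2 ≤ ε ^ 2
  · by_cases hu1 : y * (Real.exp x - 1) < P 0
    · exact ⟨x, y, 0, 0, by simpa using hxy, .inl ⟨rfl, .inr (.inr (.inr ⟨hv0, hy, hw, .inl hu1⟩))⟩⟩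
    by_cases hu2 : P 0 < y * (Real.exp x - 1) + x ^ 2 + y ^ 2 - ε ^ 2
    · exact ⟨x, y, 0, 0, by simpa using hxy, .inl ⟨rfl, .inr (.inr (.inr ⟨hv0, hy, hw, .inr hu2⟩))⟩⟩
    rw [not_lt] at hu1 hu2
    have hz := Real.sq_sqrt (sub_nonneg.2 hu2)
    exact ⟨x, y, √(P 0 - (y * (Real.exp x - 1) + x ^ 2 + y ^ 2 - ε ^ 2)), _, by linarith,
      .inr ⟨by linarith, hy, hw, rfl⟩⟩
  · refine ⟨x, 0, 0, 0, by simpa using hx2, .inl ⟨rfl, .inr (.inr (.inl ⟨hx, hk', ?_⟩))⟩⟩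
    rw [hy]
    nlinarith [mul_lt_mul_of_pos_right (not_le.1 hxy) (sq_pos_iff.2 hA)]

/-- Euclidean three-space. -/
abbrev Space : Type := EuclideanSpace ℝ (Fin 3)

theorem isSubanalyticFun_fTilde {ε : ℝ} (hε : 0 < ε) : Subanalytic.IsSubanalyticFun (fTilde ε) := by
  intro a
  -- A bounded neighbourhood cut out by polynomial inequalities, so that `A` is both bounded and
  -- semianalytic.
  let near : Space × ℝ → Prop := fun X =>
    (X.1 0 - a.1 0) ^ 2 + (X.1 1 - a.1 1) ^ 2 + (X.1 2 - a.1 2) ^ 2 < 1 ∧ (X.2 - a.2) ^ 2 < 1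
  let A : Set ((Space × ℝ) × Space) := {X | near X.1 ∧
    X.2 0 ^ 2 + X.2 1 ^ 2 + X.2 2 ^ 2 ≤ ε ^ 2 ∧
    GraphCond ε (X.1.1 0) (X.1.1 1) (X.1.1 2) X.1.2 (X.2 0) (X.2 1) (X.2 2)}
  have hsub : A ⊆ (closedBall a.1 1 ×ˢ closedBall a.2 1) ×ˢ closedBall 0 ε := by
    rintro X ⟨⟨h1, h2⟩, h3, -⟩
    refine ⟨⟨?_, ?_⟩, (mem_closedBall_three hε.le).2 h3⟩
    · rw [mem_closedBall_iff_norm, ← sq_le_sq₀ (norm_nonneg _) zero_le_one,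
        EuclideanSpace.real_norm_sq_eq, Fin.sum_univ_three, one_pow]
      exact h1.le
    · rw [mem_closedBall_iff_norm, ← sq_le_sq₀ (norm_nonneg _) zero_le_one, Real.norm_eq_abs,
        sq_abs, one_pow]
      exact h2.le
  refine ⟨{X | near X}, ?_, by simp [near], 3, A, ?_, ?_, ?_⟩
  · refine IsOpen.and ?_ ?_ <;> exact isOpen_lt (by fun_prop) (by fun_prop)
  · have h1 : ∀ i X, AnalyticAt ℝ (fun X : (Space × ℝ) × Space => X.1.1 i) X :=
      fun i X => ((EuclideanSpace.proj (𝕜 := ℝ) i).comp ((ContinuousLinearMap.fst ℝ Space ℝ).comp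
        (ContinuousLinearMap.fst ℝ (Space × ℝ) Space))).analyticAt X
    have h2 : ∀ X, AnalyticAt ℝ (fun X : (Space × ℝ) × Space => X.1.2) X := fun X =>
      ((ContinuousLinearMap.snd ℝ Space ℝ).comp (ContinuousLinearMap.fst ℝ (Space × ℝ) Space)).analyticAt X
    have h3 : ∀ i X, AnalyticAt ℝ (fun X : (Space × ℝ) × Space => X.2 i) X :=
      fun i X => ((EuclideanSpace.proj (𝕜 := ℝ) i).comp (ContinuousLinearMap.snd ℝ (Space × ℝ) Space)).analyticAt X
    refine (Subanalytic.AnalyticGenerated.and (.and (.lt (fun X => ?_) fun X => analyticAt_const)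
      (.lt (fun X => ?_) fun X => analyticAt_const)) (.and (.le (fun X => ?_)
      fun X => analyticAt_const) (analyticGenerated_graphCond ε (h1 0) (h1 1) (h1 2) h2 (h3 0)
      (h3 1) (h3 2)))).isSemianalytic
    · exact ((((h1 0 X).sub analyticAt_const).pow 2).add (((h1 1 X).sub analyticAt_const).pow 2)).add
        (((h1 2 X).sub analyticAt_const).pow 2)
    · exact ((h2 X).sub analyticAt_const).pow 2
    · exact (((h3 0 X).pow 2).add ((h3 1 X).pow 2)).add ((h3 2 X).pow 2)
  · exact ((((isCompact_closedBall _ _).prod (isCompact_closedBall _ _)).prod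
      (isCompact_closedBall _ _)).isBounded.subset hsub).isCompact_closure
  · ext ⟨P, t⟩
    constructor
    · rintro ⟨h, hU⟩
      obtain ⟨p, hp, hc⟩ := exists_graphCond hε P
      obtain rfl : t = fTilde ε P := h
      exact ⟨((P, fTilde ε P), p), ⟨hU, (mem_closedBall_three hε.le).1 hp, hc⟩, rfl⟩
    · rintro ⟨⟨X, p⟩, ⟨hU, hp, hc⟩, rfl⟩
      exact ⟨fTilde_eq_of_graphCond hε ((mem_closedBall_three hε.le).2 hp) hc, hU⟩

end Trefoil

theorem mainTheorem4 :
    ∃ ε₀ : ℝ, 0 < ε₀ ∧ ∀ ε : ℝ, 0 < ε → ε < ε₀ →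
      -- the inverse of `G` on `Γ \ {0}`, hence `φ`, `ψ` and `f`, are well defined
      (∀ r ∈ Trefoil.Gam ε \ {0}, ∃! q : EuclideanSpace ℝ (Fin 2),
        q ∈ Metric.closedBall 0 ε ∧ Trefoil.G q = r) ∧
      (∀ p ∈ Trefoil.Omega ε, !₂[p 1, p 2] ∈ Trefoil.Gam ε \ {0}) ∧
      Subanalytic.IsSubanalyticFun (Trefoil.fTilde ε) ∧
      Continuous (Trefoil.fTilde ε) ∧
      (∀ p, 0 ≤ Trefoil.fTilde ε p) ∧
      Trefoil.Omega ε = {p | 0 < Trefoil.fTilde ε p} ∧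
      ContDiffOn ℝ ∞ (Trefoil.fTilde ε) (frontier (Trefoil.Omega ε))ᶜ ∧
      ¬ Subanalytic.IsSemianalytic (Trefoil.Omega ε) := by
  -- The bound `1` is arbitrary: the argument works for every `ε > 0`.
  refine ⟨1, one_pos, fun ε hε _ => ⟨Trefoil.existsUnique_preimage,
    Trefoil.mem_Gam_of_mem_Omega hε.le, Trefoil.isSubanalyticFun_fTilde hε,
    Trefoil.continuous_fTilde hε.le, Trefoil.fTilde_nonneg hε.le, Trefoil.Omega_eq hε.le,
    Trefoil.contDiffOn_fTilde hε.le, Trefoil.not_isSemianalytic_Omega hε⟩⟩
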